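/- Let $A(\mathbb D)$ be the disc algebra, i.e. the algebra of continuous functions $f:\overline{\mathbb D}\to\mathbb C$ on the closed unit disc that are holomorphic on the open unit disc $\mathbb D$, with norm $\|f\|=\sup_{z\in\overline{\mathbb D}}|f(z)|$. Let $n\ge 1$ be an integer, let $\omega\in\mathbb C$ satisfy $\omega^n=1$, and let $\mathbb Z/n\mathbb Z$ act on $A(\mathbb D)$ by $(\alpha^k f)(z)=f(\omega^k z)$. Let $\ell^1(\mathbb Z/n\mathbb Z,A(\mathbb D),\alpha)$ be the unital algebra of all functions $f:\mathbb Z/n\mathbb Z\to A(\mathbb D)$ with the norm $\|f\|=\sum_{k}\|f(k)\|$ and the twisted convolution product $$(f_1*f_2)(k)=\sum_{h\in\mathbb Z/n\mathbb Z} f_1(h)\,\alpha^h\bigl(f_2(k-h)\bigr).$$ For a unital Banach algebra $B$, let $Lg_m(B)\subset B^m$ be the set of $m$-tuples that generate $B$ as a left ideal, and let the left topological stable rank $\mathrm{ltsr}(B)$ be the least $m\ge 1$ such that $Lg_m(B)$ is dense in $B^m$ ($\infty$ if there is no such $m$). Then $$\mathrm{ltsr}\bigl(\ell^1(\mathbb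 Z/n\mathbb Z,A(\mathbb D),\alpha)\bigr)=2 .$$ -/

import Mathlib

noncomputable section

/-- `Lg m A`: the `m`-tuples of elements of `A` that generate `A` as a left ideal
(`Ideal` means left ideal over a noncommutative ring). -/
def Lg (m : ℕ) (A : Type*) [Ring A] : Set (Fin m → A) :=
  {a | Ideal.span (Set.range a) = ⊤}

/-- Left topological stable rank: the least `m ≥ 1` such that `Lg m A` is dense in `A ^ m`,
and `⊤` (that is, `∞`) if there is no such `m`. -/
def ltsr (A : Type*) [Ring A] [TopologicalSpace A] : ℕ∞ :=
  ⨅ (m : ℕ) (_ : 1 ≤ m ∧ Dense (Lg m A)), (m : ℕ∞)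

section CrossedProduct

variable {G A : Type*} [Group G] [Fintype G] [NormedRing A] [NormedAlgebra ℂ A]

/-- An action `g ↦ α^g` of `G` on `A` by bounded algebra automorphisms with bounded inverse.
(Since `G` is finite, `sup_g ‖α^g‖ < ∞` is automatic.) -/
structure AutAction (G A : Type*) [Group G] [NormedRing A] [NormedAlgebra ℂ A] where
  aut : G → (A ≃A[ℂ] A)
  aut_one : ∀ a, aut 1 a = a
  aut_mul : ∀ g h a, aut (g * h) a = aut g (aut h a)

/-- The algebra `ℓ¹(G, A, α)` of an action `α` of a finite group `G` on `A`: the functions `f : G → A` with the norm `∑ g, ‖f g‖`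
and the `α`-twisted convolution product defined below. -/
def L1CrossedProduct (_α : AutAction G A) : Type _ := PiLp 1 (fun _ : G => A)

namespace L1CrossedProduct

variable (α : AutAction G A)

instance : NormedAddCommGroup (L1CrossedProduct α) :=
  inferInstanceAs (NormedAddCommGroup (PiLp 1 (fun _ : G => A)))

variable {α}

/-- The element of `ℓ¹(G, A, α)` with the given coefficients. -/
def mk (f : G → A) : L1CrossedProduct α := WithLp.toLp (V := G → A) 1 f

/-- The coefficients of an element of `ℓ¹(G, A, α)`. -/
def coeff (f : L1CrossedProduct α) : G → A := WithLp.ofLp (V := G → A) (p := 1) f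

/-- `(f₁ * f₂)(g) = ∑ h, f₁(h) α^h(f₂(h⁻¹ g))`. -/
instance : Mul (L1CrossedProduct α) :=
  ⟨fun f₁ f₂ => mk fun g => ∑ h, f₁.coeff h * α.aut h (f₂.coeff (h⁻¹ * g))⟩

open Classical in
/-- The unit `δ^e`. -/
instance : One (L1CrossedProduct α) := ⟨mk (Pi.single 1 1)⟩

theorem ext {f₁ f₂ : L1CrossedProduct α} (h : ∀ g, f₁.coeff g = f₂.coeff g) : f₁ = f₂ :=
  PiLp.ext h

theorem coeff_mul (f₁ f₂ : L1CrossedProduct α) (g : G) :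
    (f₁ * f₂).coeff g = ∑ h, f₁.coeff h * α.aut h (f₂.coeff (h⁻¹ * g)) := rfl

open Classical in
theorem coeff_one (g : G) :
    (1 : L1CrossedProduct α).coeff g = Pi.single (M := fun _ : G => A) 1 1 g := rfl

theorem coeff_add (f₁ f₂ : L1CrossedProduct α) (g : G) :
    (f₁ + f₂).coeff g = f₁.coeff g + f₂.coeff g := rfl

theorem coeff_zero (g : G) : (0 : L1CrossedProduct α).coeff g = 0 := rfl

theorem norm_eq (f : L1CrossedProduct α) : ‖f‖ = ∑ g, ‖f.coeff g‖ :=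
  PiLp.norm_eq_of_L1 (β := fun _ : G => A) f

instance : Ring (L1CrossedProduct α) :=
  { (inferInstance : AddCommGroup (L1CrossedProduct α)),
    (inferInstance : Mul (L1CrossedProduct α)),
    (inferInstance : One (L1CrossedProduct α)) with
    left_distrib := fun a b c => ext fun g => by
      simp only [coeff_mul, coeff_add, map_add, mul_add, Finset.sum_add_distrib]
    right_distrib := fun a b c => ext fun g => by
      simp only [coeff_mul, coeff_add, add_mul, Finset.sum_add_distrib]
    zero_mul := fun a => ext fun g => by simp [coeff_mul, coeff_zero]
    mul_zero := fun a => ext fun g => by simp [coeff_mul, coeff_zero]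
    one_mul := fun a => ext fun g => by
      classical
      rw [coeff_mul, Finset.sum_eq_single 1]
      · simp [coeff_one, α.aut_one]
      · intro h _ hh
        simp [coeff_one, hh]
      · simp
    mul_one := fun a => ext fun g => by
      classical
      rw [coeff_mul, Finset.sum_eq_single g]
      · simp [coeff_one]
      · intro h _ hh
        have : h⁻¹ * g ≠ 1 := fun e => hh (inv_mul_eq_one.mp e)
        simp [coeff_one, this]
      · simp
    mul_assoc := fun a b c => ext fun g => by
      simp only [coeff_mul, Finset.sum_mul, map_sum, map_mul, Finset.mul_sum]
      rw [Finset.sum_comm]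
      refine Finset.sum_congr rfl fun h _ => ?_
      refine Fintype.sum_equiv (Equiv.mulLeft h⁻¹) _ _ fun k => ?_
      have e : ∀ x, α.aut k x = α.aut h (α.aut (h⁻¹ * k) x) := fun x => by
        rw [← α.aut_mul, mul_inv_cancel_left]
      simp only [Equiv.coe_mulLeft, mul_assoc, mul_inv_rev, inv_inv, e, mul_inv_cancel_left] }

end L1CrossedProduct

end CrossedProduct

/-- The disc algebra `A(𝔻)`: the continuous functions on the closed unit disc that are
holomorphic on the open unit disc, with the supremum norm (as a subalgebra of
`C(closedBall 0 1, ℂ)`). The function `Function.extend Subtype.val f 0` is `f` on the closed disc,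
extended by `0` to `ℂ`. -/
def DiscAlgebra : Subalgebra ℂ C(Metric.closedBall (0 : ℂ) 1, ℂ) where
  carrier := {f | DifferentiableOn ℂ (Function.extend Subtype.val f 0) (Metric.ball 0 1)}
  mul_mem' {f g} hf hg := by
    refine (DifferentiableOn.mul hf hg).congr fun z hz => ?_
    have e (k : C(Metric.closedBall (0 : ℂ) 1, ℂ)) : Function.extend Subtype.val k 0 z
        = k ⟨z, Metric.ball_subset_closedBall hz⟩ :=
      Subtype.val_injective.extend_apply k 0 ⟨z, Metric.ball_subset_closedBall hz⟩
    rw [Pi.mul_apply, e f, e g]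
    exact e (f * g)
  add_mem' {f g} hf hg := by
    refine (DifferentiableOn.add hf hg).congr fun z hz => ?_
    have e (k : C(Metric.closedBall (0 : ℂ) 1, ℂ)) : Function.extend Subtype.val k 0 z
        = k ⟨z, Metric.ball_subset_closedBall hz⟩ :=
      Subtype.val_injective.extend_apply k 0 ⟨z, Metric.ball_subset_closedBall hz⟩
    rw [Pi.add_apply, e f, e g]
    exact e (f + g)
  algebraMap_mem' c := by
    refine (differentiableOn_const c).congr fun z hz => ?_
    exact Subtype.val_injective.extend_apply
      (algebraMap ℂ C(Metric.closedBall (0 : ℂ) 1, ℂ) c) (0 : ℂ → ℂ)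
      ⟨z, Metric.ball_subset_closedBall hz⟩

namespace DiscAlgebra

/-- The rotation `z ↦ u z` of the closed unit disc. -/
def rotateDisc (u : Circle) : C(Metric.closedBall (0 : ℂ) 1, Metric.closedBall (0 : ℂ) 1) where
  toFun z := ⟨u * z, by
    rw [mem_closedBall_zero_iff, norm_mul, Circle.norm_coe, one_mul]
    exact mem_closedBall_zero_iff.1 z.2⟩
  continuous_toFun := by fun_prop

theorem comp_rotateDisc_mem (u : Circle) (f : DiscAlgebra) :
    f.1.comp (rotateDisc u) ∈ DiscAlgebra := by
  have hmaps : Set.MapsTo (fun z : ℂ => (u : ℂ) * z) (Metric.ball 0 1) (Metric.ball 0 1) := by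
    intro z hz
    rw [mem_ball_zero_iff] at hz ⊢
    rwa [norm_mul, Circle.norm_coe, one_mul]
  have hf : DifferentiableOn ℂ (Function.extend Subtype.val f.1 0) (Metric.ball 0 1) := f.2
  refine (hf.comp (differentiableOn_id.const_mul (u : ℂ)) hmaps).congr fun z hz => ?_
  have e (k : C(Metric.closedBall (0 : ℂ) 1, ℂ)) (w : ℂ) (hw : w ∈ Metric.ball (0 : ℂ) 1) :
      Function.extend Subtype.val k 0 w = k ⟨w, Metric.ball_subset_closedBall hw⟩ :=
    Subtype.val_injective.extend_apply k 0 ⟨w, Metric.ball_subset_closedBall hw⟩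
  rw [e _ z hz]
  exact (e f.1 _ (hmaps hz)).symm

/-- The automorphism `f ↦ (z ↦ f (u z))` of `A(𝔻)`. -/
def rotation (u : Circle) : DiscAlgebra ≃A[ℂ] DiscAlgebra where
  toFun f := ⟨f.1.comp (rotateDisc u), comp_rotateDisc_mem u f⟩
  invFun f := ⟨f.1.comp (rotateDisc u⁻¹), comp_rotateDisc_mem u⁻¹ f⟩
  left_inv f := by
    refine Subtype.ext (ContinuousMap.ext fun z => ?_)
    exact congrArg f.1 (Subtype.ext (by simp [rotateDisc]))
  right_inv f := by
    refine Subtype.ext (ContinuousMap.ext fun z => ?_)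
    exact congrArg f.1 (Subtype.ext (by simp [rotateDisc]))
  map_mul' _ _ := rfl
  map_add' _ _ := rfl
  commutes' _ := rfl
  continuous_toFun := by
    refine Continuous.subtype_mk ?_ _
    exact (ContinuousMap.continuous_precomp (rotateDisc u)).comp continuous_subtype_val
  continuous_invFun := by
    refine Continuous.subtype_mk ?_ _
    exact (ContinuousMap.continuous_precomp (rotateDisc u⁻¹)).comp continuous_subtype_val

theorem rotation_apply (u : Circle) (f : DiscAlgebra) (z w : Metric.closedBall (0 : ℂ) 1)
    (hw : (w : ℂ) = u * z) : (rotation u f).1 z = f.1 w :=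
  congrArg f.1 (Subtype.ext hw.symm)

theorem rotation_one (f : DiscAlgebra) : rotation 1 f = f :=
  Subtype.ext (ContinuousMap.ext fun z => rotation_apply 1 f z z (by simp))

theorem rotation_mul (u v : Circle) (f : DiscAlgebra) :
    rotation (u * v) f = rotation u (rotation v f) := by
  refine Subtype.ext (ContinuousMap.ext fun z => ?_)
  refine congrArg f.1 (Subtype.ext ?_)
  simp only [rotateDisc, ContinuousMap.coe_mk, Circle.coe_mul]
  ring

/-- The action `k ↦ α ^ k` of `ℤ/nℤ` on `A(𝔻)`, where `(α f)(z) = f (ω z)` and `ω ^ n = 1`. -/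
def rotationAction (n : ℕ) [NeZero n] (ω : ℂ) (hω : ω ^ n = 1) :
    AutAction (Multiplicative (ZMod n)) DiscAlgebra :=
  let u : Circle := ⟨ω, mem_sphere_zero_iff_norm.2
    (Complex.norm_eq_one_of_pow_eq_one hω (NeZero.ne n))⟩
  { aut := fun k => rotation (u ^ k.toAdd.val)
    aut_one := fun f => by
      rw [toAdd_one, ZMod.val_zero, pow_zero, rotation_one]
    aut_mul := fun j k f => by
      have hu : u ^ n = 1 := Subtype.ext hω
      rw [← rotation_mul, ← pow_add, toAdd_mul, ZMod.val_add, ← pow_eq_pow_mod _ hu] }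

theorem rotationAction_apply (n : ℕ) [NeZero n] (ω : ℂ) (hω : ω ^ n = 1)
    (k : Multiplicative (ZMod n)) (f : DiscAlgebra) (z w : Metric.closedBall (0 : ℂ) 1)
    (hw : (w : ℂ) = ω ^ k.toAdd.val * z) :
    ((rotationAction n ω hω).aut k f).1 z = f.1 w :=
  rotation_apply _ f z w hw

end DiscAlgebra

end

/-! Right multiplication by `f` is `A`-linear on the crossed product, a free left `A`-module of rank
`|G|`, so `f` has a matrix over the commutative ring `A` and a determinant in `A`. The determinant
reduces both bounds to the disc algebra. Upper bound: by Cramer's rule the left ideal of `f`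
contains `det f`, so two elements with coprime determinants generate
(`pair_mem_Lg_of_isCoprime_det`). Polynomial coefficients are dense and give polynomial
determinants; adding a scalar to each element removes common zeros in the closed disc, and
polynomials without common zeros there are coprime in `A(𝔻)` (`dense_Lg_two`). Lower bound: a left
invertible element has a unit determinant, and the determinant is continuous. The determinant of `z
δ^e` is a product of rotations of `z`: it vanishes at 0 and is unimodular on the circle. By the
maximum principle it is not a limit of units (`notMem_closure_isUnit`). -/

open Metric

noncomputable section

/-! ### Determinants in a crossed product over a commutative algebra -/

namespace L1CrossedProduct

variable {G A : Type*} [Group G] [Fintype G] [DecidableEq G] [NormedCommRing A]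
  [NormedAlgebra ℂ A] {α : AutAction G A}

/-- The matrix of the `A`-linear map `x ↦ x * f` in the basis `δ^g` of the left `A`-module
`ℓ¹(G, A, α)`. -/
def rightMulMatrix (f : L1CrossedProduct α) : Matrix G G A :=
  Matrix.of fun g h => α.aut h (f.coeff (h⁻¹ * g))

theorem rightMulMatrix_apply (f : L1CrossedProduct α) (g h : G) :
    rightMulMatrix f g h = α.aut h (f.coeff (h⁻¹ * g)) := rfl

theorem coeff_mul_eq_mulVec (x f : L1CrossedProduct α) :
    (x * f).coeff = (rightMulMatrix f).mulVec x.coeff := by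
  ext g
  simp only [coeff_mul, Matrix.mulVec, dotProduct, rightMulMatrix_apply, mul_comm]

theorem rightMulMatrix_one : rightMulMatrix (1 : L1CrossedProduct α) = 1 := by
  ext g h
  rw [rightMulMatrix_apply, coeff_one, Matrix.one_apply]
  by_cases hgh : g = h
  · subst hgh; simp
  · have : h⁻¹ * g ≠ 1 := fun e => hgh (inv_mul_eq_one.mp e).symm
    simp [hgh, this]

/-- The order is reversed because right multiplications compose in the opposite order; determinants
do not see this. -/
theorem rightMulMatrix_mul (f₁ f₂ : L1CrossedProduct α) :
    rightMulMatrix (f₁ * f₂) = rightMulMatrix f₂ * rightMulMatrix f₁ := by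
  ext g h
  simp only [Matrix.mul_apply, rightMulMatrix_apply, coeff_mul, map_sum, map_mul]
  refine Fintype.sum_equiv (Equiv.mulLeft h) _ _ fun k => ?_
  simp only [Equiv.coe_mulLeft, inv_mul_cancel_left, α.aut_mul, mul_inv_rev, mul_assoc]
  rw [mul_comm]

theorem rightMulMatrix_add (f₁ f₂ : L1CrossedProduct α) :
    rightMulMatrix (f₁ + f₂) = rightMulMatrix f₁ + rightMulMatrix f₂ := by
  ext g h
  simp [rightMulMatrix_apply, coeff_add]

theorem continuous_coeff (g : G) : Continuous fun f : L1CrossedProduct α => f.coeff g :=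
  PiLp.continuous_apply 1 (fun _ : G => A) g

theorem continuous_mk : Continuous (mk : (G → A) → L1CrossedProduct α) :=
  PiLp.continuous_toLp 1 (fun _ : G => A)

theorem continuous_det_rightMulMatrix :
    Continuous fun f : L1CrossedProduct α => (rightMulMatrix f).det := by
  refine Continuous.matrix_det (continuous_matrix fun g h => ?_)
  exact (α.aut h).continuous.comp (continuous_coeff _)

theorem isUnit_det_rightMulMatrix {x f : L1CrossedProduct α} (h : x * f = 1) :
    IsUnit (rightMulMatrix f).det := by
  have := congrArg (fun y => (rightMulMatrix y).det) h
  simp only [rightMulMatrix_mul, rightMulMatrix_one, Matrix.det_mul, Matrix.det_one] at this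
  exact IsUnit.of_mul_eq_one _ this

/-- The element `a δ^e`. -/
def single (a : A) : L1CrossedProduct α := mk (Pi.single 1 a)

theorem coeff_single (a : A) (g : G) :
    (single a : L1CrossedProduct α).coeff g = if g = 1 then a else 0 := by
  change (Pi.single 1 a : G → A) g = _
  rw [Pi.single_apply]

theorem single_one : (single 1 : L1CrossedProduct α) = 1 := by
  refine ext fun g => ?_
  by_cases h : g = 1 <;> simp [coeff_single, coeff_one, h]

theorem coeff_single_mul (a : A) (f : L1CrossedProduct α) (g : G) :
    (single a * f).coeff g = a * f.coeff g := by
  rw [coeff_mul, Finset.sum_eq_single 1]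
  · simp [coeff_single, α.aut_one]
  · intro h _ hh
    simp [coeff_single, hh]
  · simp

theorem single_add (a b : A) : (single (a + b) : L1CrossedProduct α) = single a + single b := by
  refine ext fun g => ?_
  rw [coeff_add]
  simp only [coeff_single]
  split_ifs <;> simp

theorem single_mul_single (a b : A) :
    (single a * single b : L1CrossedProduct α) = single (a * b) := by
  refine ext fun g => ?_
  simp [coeff_single_mul, coeff_single]

theorem continuous_single : Continuous (single : A → L1CrossedProduct α) :=
  continuous_mk.comp (_root_.continuous_single (A := fun _ : G => A) 1)

theorem rightMulMatrix_single (a : A) :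
    rightMulMatrix (single a : L1CrossedProduct α) = Matrix.diagonal fun h => α.aut h a := by
  ext g h
  rw [rightMulMatrix_apply, coeff_single, Matrix.diagonal_apply]
  by_cases hgh : g = h
  · subst hgh; simp
  · have : h⁻¹ * g ≠ 1 := fun e => hgh (inv_mul_eq_one.mp e).symm
    simp [hgh, this]

/-- Algebra automorphisms fix constants, so adding a constant to `f` shifts its matrix by a scalar
matrix. -/
theorem rightMulMatrix_single_algebraMap (c : ℂ) :
    rightMulMatrix (single (algebraMap ℂ A c) : L1CrossedProduct α)
      = Matrix.scalar G (algebraMap ℂ A c) := by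
  have e : ∀ h, α.aut h (algebraMap ℂ A c) = algebraMap ℂ A c :=
    fun h => (α.aut h).toAlgEquiv.commutes c
  simp only [rightMulMatrix_single, e]
  rfl

/-- Cramer's rule: the coefficients of `x` are the column of the adjugate at the identity of `G`. -/
theorem exists_mul_eq_single_det (f : L1CrossedProduct α) :
    ∃ x, x * f = single (rightMulMatrix f).det := by
  refine ⟨mk ((rightMulMatrix f).adjugate.mulVec (Pi.single 1 1)), ext fun g => ?_⟩
  rw [coeff_mul_eq_mulVec]
  change (rightMulMatrix f).mulVec ((rightMulMatrix f).adjugate.mulVec (Pi.single 1 1)) g = _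
  rw [Matrix.mulVec_mulVec, Matrix.mul_adjugate, coeff_single]
  simp [Matrix.one_apply]

theorem pair_mem_Lg_of_isCoprime_det {f₁ f₂ : L1CrossedProduct α}
    (h : IsCoprime (rightMulMatrix f₁).det (rightMulMatrix f₂).det) :
    ![f₁, f₂] ∈ Lg 2 (L1CrossedProduct α) := by
  obtain ⟨a, b, hab⟩ := h
  obtain ⟨x₁, h₁⟩ := exists_mul_eq_single_det f₁
  obtain ⟨x₂, h₂⟩ := exists_mul_eq_single_det f₂
  refine (Ideal.eq_top_iff_one _).2 ?_
  have key : single a * x₁ * f₁ + single b * x₂ * f₂ = 1 := by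
    rw [mul_assoc, mul_assoc, h₁, h₂, single_mul_single, single_mul_single, ← single_add, hab,
      single_one]
  rw [← key]
  exact Ideal.add_mem _ (Ideal.mul_mem_left _ _ (Ideal.subset_span ⟨0, rfl⟩))
    (Ideal.mul_mem_left _ _ (Ideal.subset_span ⟨1, rfl⟩))

theorem isUnit_det_of_mem_Lg_one {f : Fin 1 → L1CrossedProduct α}
    (h : f ∈ Lg 1 (L1CrossedProduct α)) : IsUnit (rightMulMatrix (f 0)).det := by
  have h1 : (1 : L1CrossedProduct α) ∈ Ideal.span (Set.range f) := (Ideal.eq_top_iff_one _).1 h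
  rw [Set.range_unique, Fin.default_eq_zero] at h1
  obtain ⟨x, hx⟩ := Submodule.mem_span_singleton.1 h1
  exact isUnit_det_rightMulMatrix hx

theorem dense_setOf_coeff_mem {S : Set A} (hS : Dense S) :
    Dense {f : L1CrossedProduct α | ∀ g, f.coeff g ∈ S} := by
  have h := dense_pi (Set.univ : Set G) (s := fun _ => S) fun _ _ => hS
  have hsurj : Function.Surjective (mk : (G → A) → L1CrossedProduct α) :=
    fun f => ⟨f.coeff, ext fun _ => rfl⟩
  refine (hsurj.denseRange.dense_image continuous_mk h).mono ?_
  rintro _ ⟨f, hf, rfl⟩ g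
  exact hf g trivial

/-- Only finitely many scalar perturbations of `f` have a determinant killed by a character. -/
theorem finite_det_add_single_eq_zero (φ : A →ₐ[ℂ] ℂ) (f : L1CrossedProduct α) :
    {c : ℂ | φ (rightMulMatrix (f + single (algebraMap ℂ A c))).det = 0}.Finite := by
  -- As a function of `c`, the determinant is the characteristic polynomial of `-φ(M)`, with `M` the
  -- matrix of `f`; it is monic, hence nonzero.
  refine (Polynomial.finite_setOfPred_isRoot
    (Matrix.charpoly_monic (-(rightMulMatrix f).map φ)).ne_zero).subset fun c hc => ?_
  rw [Set.mem_ofPred_eq, AlgHom.map_det, rightMulMatrix_add, rightMulMatrix_single_algebraMap] at hc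
  rw [Set.mem_ofPred_eq, Polynomial.IsRoot, Matrix.eval_charpoly, sub_neg_eq_add, add_comm, ← hc]
  congr 1
  ext g h
  simp [Matrix.diagonal_apply, apply_ite φ]

end L1CrossedProduct

/-! ### The disc algebra: units, the maximum principle, polynomials -/

namespace DiscAlgebra

/-- Evaluation at a point of the closed disc. -/
def eval (z : closedBall (0 : ℂ) 1) : DiscAlgebra →ₐ[ℂ] ℂ :=
  (ContinuousMap.evalAlgHom ℂ ℂ z).comp DiscAlgebra.val

theorem norm_eval_le (z : closedBall (0 : ℂ) 1) (f : DiscAlgebra) : ‖eval z f‖ ≤ ‖f‖ :=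
  f.1.norm_coe_le_norm z

theorem extend_apply (f : C(closedBall (0 : ℂ) 1, ℂ)) {z : ℂ} (hz : z ∈ closedBall (0 : ℂ) 1) :
    Function.extend Subtype.val f 0 z = f ⟨z, hz⟩ :=
  Subtype.val_injective.extend_apply f 0 ⟨z, hz⟩

theorem continuousOn_extend (f : C(closedBall (0 : ℂ) 1, ℂ)) :
    ContinuousOn (Function.extend Subtype.val f 0) (closedBall (0 : ℂ) 1) := by
  rw [continuousOn_iff_continuous_domRestrict]
  convert f.continuous using 1
  ext z
  exact extend_apply f z.2

theorem diffContOnCl_extend (f : DiscAlgebra) :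
    DiffContOnCl ℂ (Function.extend Subtype.val f.1 0) (ball (0 : ℂ) 1) :=
  ⟨f.2, by rw [closure_ball _ one_ne_zero]; exact continuousOn_extend f.1⟩

/-- A holomorphic function near the closed disc, as an element of `A(𝔻)`. -/
def ofDifferentiableOn (F : ℂ → ℂ) (hc : ContinuousOn F (closedBall 0 1))
    (hd : DifferentiableOn ℂ F (ball 0 1)) : DiscAlgebra :=
  ⟨⟨fun z => F z, continuousOn_iff_continuous_domRestrict.1 hc⟩,
    hd.congr fun _ hz => extend_apply _ (ball_subset_closedBall hz)⟩

theorem isUnit_of_eval_ne_zero {f : DiscAlgebra} (h : ∀ z, eval z f ≠ 0) : IsUnit f := by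
  have h' : ∀ z ∈ closedBall (0 : ℂ) 1, Function.extend Subtype.val f.1 0 z ≠ 0 := fun z hz => by
    rw [extend_apply _ hz]; exact h ⟨z, hz⟩
  refine IsUnit.of_mul_eq_one (ofDifferentiableOn (Function.extend Subtype.val f.1 0)⁻¹
    ((continuousOn_extend f.1).inv₀ h')
    (DifferentiableOn.inv f.2 fun z hz => h' z (ball_subset_closedBall hz))) ?_
  refine Subtype.ext (ContinuousMap.ext fun z => ?_)
  change f.1 z * (Function.extend Subtype.val f.1 0 z)⁻¹ = 1
  rw [extend_apply _ z.2]
  exact mul_inv_cancel₀ (h z)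

theorem norm_eval_le_of_forall_sphere {f : DiscAlgebra} {C : ℝ}
    (h : ∀ z : closedBall (0 : ℂ) 1, ‖(z : ℂ)‖ = 1 → ‖eval z f‖ ≤ C) (z : closedBall (0 : ℂ) 1) : ‖eval z f‖ ≤ C := by
  have := Complex.norm_le_of_forall_mem_frontier_norm_le (isBounded_ball (x := (0 : ℂ)) (r := 1))
    (diffContOnCl_extend f) (C := C) (fun w hw => ?_) (z := z)
    (by rw [closure_ball _ one_ne_zero]; exact z.2)
  · rwa [extend_apply _ z.2] at this
  · rw [frontier_ball _ one_ne_zero] at hw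
    rw [extend_apply _ (sphere_subset_closedBall hw)]
    exact h _ (mem_sphere_zero_iff_norm.1 hw)

/-- The centre of the closed disc. -/
def center : closedBall (0 : ℂ) 1 := ⟨0, mem_closedBall_self zero_le_one⟩

/-- A unit `u` within 1/3 of `p` has `|u| > 2/3` on the circle, so `|1/u| ≤ 3/2` there, and at 0 by
the maximum principle. But `|u(0)| < 1/3`, which forces `|1/u(0)| > 3`. -/
theorem notMem_closure_isUnit {p : DiscAlgebra} (h0 : eval center p = 0)
    (h1 : ∀ z : closedBall (0 : ℂ) 1, ‖(z : ℂ)‖ = 1 → ‖eval z p‖ = 1) : p ∉ closure {u : DiscAlgebra | IsUnit u} := by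
  intro hp
  obtain ⟨u, ⟨u, rfl⟩, hu⟩ := Metric.mem_closure_iff.1 hp (1 / 3) (by norm_num)
  rw [dist_eq_norm] at hu
  have hle : ∀ z, ‖eval z p - eval z u‖ < 1 / 3 := fun z => by
    rw [← map_sub]; exact (norm_eval_le z _).trans_lt hu
  have hmul : ∀ z, ‖eval z (↑u⁻¹ : DiscAlgebra)‖ * ‖eval z (u : DiscAlgebra)‖ = 1 := fun z => by
    rw [← norm_mul, ← map_mul, Units.inv_mul, map_one, norm_one]
  have hb : ∀ z : closedBall (0 : ℂ) 1, ‖(z : ℂ)‖ = 1 → ‖eval z (↑u⁻¹ : DiscAlgebra)‖ ≤ 3 / 2 := fun z hz => by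
    have e1 := hle z
    have e2 := hmul z
    have e3 := norm_sub_norm_le (eval z p) (eval z (u : DiscAlgebra))
    rw [h1 z hz] at e3
    nlinarith [norm_nonneg (eval z (↑u⁻¹ : DiscAlgebra))]
  have e1 := norm_eval_le_of_forall_sphere hb center
  have e2 := hmul center
  have e3 := hle center
  rw [h0, zero_sub, norm_neg] at e3
  nlinarith [norm_nonneg (eval center (↑u⁻¹ : DiscAlgebra)),
    norm_nonneg (eval center (u : DiscAlgebra))]

/-- The coordinate function `z`. -/
def coord : DiscAlgebra :=
  ofDifferentiableOn id continuousOn_id differentiableOn_id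

theorem eval_coord (z : closedBall (0 : ℂ) 1) : eval z coord = z := rfl

/-- The subalgebra of polynomials in `z`. -/
def polynomials : Subalgebra ℂ DiscAlgebra := (Polynomial.aeval coord).range

theorem eval_aeval_coord (z : closedBall (0 : ℂ) 1) (P : Polynomial ℂ) :
    eval z (Polynomial.aeval coord P) = P.eval (z : ℂ) := by
  rw [← Polynomial.aeval_algHom_apply, eval_coord, Polynomial.coe_aeval_eq_eval]

theorem ext_eval {f g : DiscAlgebra} (h : ∀ z, eval z f = eval z g) : f = g :=
  Subtype.ext (ContinuousMap.ext h)

theorem rotation_mem_polynomials (u : Circle) {f : DiscAlgebra} (hf : f ∈ polynomials) :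
    rotation u f ∈ polynomials := by
  obtain ⟨P, rfl⟩ := hf
  refine ⟨P.comp (Polynomial.C (u : ℂ) * Polynomial.X), ext_eval fun z => ?_⟩
  have : eval z (rotation u (Polynomial.aeval coord P))
      = eval (rotateDisc u z) (Polynomial.aeval coord P) := rfl
  change eval z (Polynomial.aeval coord _) = eval z (rotation u (Polynomial.aeval coord P))
  rw [this, eval_aeval_coord, eval_aeval_coord]
  simp [rotateDisc]

theorem norm_le_of_forall_eval {f : DiscAlgebra} {C : ℝ} (hC : 0 ≤ C)
    (h : ∀ z, ‖eval z f‖ ≤ C) : ‖f‖ ≤ C :=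
  (ContinuousMap.norm_le f.1 hC).2 h

/-- By uniform continuity `f` is close to its dilation `z ↦ f(rz)` for `r < 1` near 1, and the
Taylor series of the dilation converges uniformly on the closed disc. -/
theorem dense_polynomials : Dense (polynomials : Set DiscAlgebra) := by
  intro f
  rw [Metric.mem_closure_iff]
  intro ε hε
  obtain ⟨δ, hδ, hfδ⟩ := Metric.uniformContinuous_iff.1
    (CompactSpace.uniformContinuous_of_continuous f.1.continuous) (ε / 3) (by positivity)
  obtain ⟨r, hr0, hr1, hrδ⟩ : ∃ r : ℝ, 0 < r ∧ r < 1 ∧ 1 - r < δ := by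
    refine ⟨max (1 / 2) (1 - δ / 2), by positivity, max_lt (by norm_num) (by linarith), ?_⟩
    linarith [le_max_right (1 / 2 : ℝ) (1 - δ / 2)]
  set F : ℂ → ℂ := Function.extend Subtype.val f.1 0
  have hF : DifferentiableOn ℂ F (ball 0 1) := f.2
  -- With `r < s < t < 1`, the power series is taken on the disc of radius `t`, converges uniformly
  -- on the open disc of radius `s`, and that disc contains every `rz`.
  obtain ⟨t, hrt, ht1⟩ := exists_between hr1
  obtain ⟨s, hrs, hst⟩ := exists_between hrt
  lift t to NNReal using (hr0.trans hrt).le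
  lift s to NNReal using (hr0.trans hrs).le
  have hps := (hF.mono (closedBall_subset_ball ht1)).hasFPowerSeriesOnBall
    (by exact_mod_cast hr0.trans hrt : 0 < t)
  obtain ⟨N, hN⟩ := (Metric.tendstoUniformlyOn_iff.1
    (hps.tendstoUniformlyOn (r' := s) (by exact_mod_cast hst)) (ε / 3) (by positivity)).exists
  set p := cauchyPowerSeries F 0 t
  let P : Polynomial ℂ := ∑ i ∈ Finset.range N,
    Polynomial.C (p.coeff i) * (Polynomial.C (r : ℂ) * Polynomial.X) ^ i
  have hP : ∀ z : ℂ, P.eval z = p.partialSum N (r * z) := fun z => by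
    rw [FormalMultilinearSeries.partialSum, Polynomial.eval_finsetSum]
    refine Finset.sum_congr rfl fun i _ => ?_
    rw [FormalMultilinearSeries.apply_eq_pow_smul_coeff, smul_eq_mul, mul_comm]
    simp only [Polynomial.eval_mul, Polynomial.eval_pow, Polynomial.eval_C, Polynomial.eval_X]
  refine ⟨Polynomial.aeval coord P, ⟨P, rfl⟩, ?_⟩
  rw [dist_eq_norm]
  refine (norm_le_of_forall_eval (C := ε / 3 + ε / 3) (by positivity) fun z => ?_).trans_lt
    (by linarith)
  have hz : ‖(z : ℂ)‖ ≤ 1 := mem_closedBall_zero_iff.1 z.2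
  have hrz : ‖(r : ℂ) * z‖ ≤ r := by
    rw [norm_mul, Complex.norm_of_nonneg hr0.le]
    exact mul_le_of_le_one_right hr0.le hz
  have hw : (r : ℂ) * z ∈ closedBall (0 : ℂ) 1 := mem_closedBall_zero_iff.2 (hrz.trans hr1.le)
  have e1 := @hfδ z ⟨r * z, hw⟩ (by
    rw [Subtype.dist_eq, Complex.dist_eq, ← one_sub_mul, norm_mul, ← Complex.ofReal_one,
      ← Complex.ofReal_sub, Complex.norm_of_nonneg (by linarith)]
    exact (mul_le_of_le_one_right (by linarith) hz).trans_lt hrδ)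
  have e2 := hN (r * z) (mem_ball_zero_iff.2 (hrz.trans_lt hrs))
  rw [zero_add, ← hP, show F (r * z) = f.1 ⟨r * z, hw⟩ from extend_apply _ hw] at e2
  rw [map_sub, eval_aeval_coord, ← dist_eq_norm]
  exact (dist_triangle _ _ _).trans (add_le_add e1.le e2.le)

/-- The gcd in `ℂ[X]` may have roots outside the closed disc, but none inside, so it is a unit of
`A(𝔻)`; dividing Bézout's identity by it gives coprimality. -/
theorem isCoprime_of_mem_polynomials {p q : DiscAlgebra} (hp : p ∈ polynomials)
    (hq : q ∈ polynomials) (h : ∀ z, eval z p = 0 → eval z q ≠ 0) : IsCoprime p q := by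
  obtain ⟨P, rfl⟩ := hp
  obtain ⟨Q, rfl⟩ := hq
  change IsCoprime (Polynomial.aeval coord P) (Polynomial.aeval coord Q)
  have hu : IsUnit (Polynomial.aeval coord (EuclideanDomain.gcd P Q)) := by
    refine isUnit_of_eval_ne_zero fun z hz => h z ?_ ?_
    · obtain ⟨R, hR⟩ := EuclideanDomain.gcd_dvd_left P Q
      change eval z (Polynomial.aeval coord P) = 0
      rw [hR, map_mul, map_mul, hz, zero_mul]
    · obtain ⟨R, hR⟩ := EuclideanDomain.gcd_dvd_right P Q
      change eval z (Polynomial.aeval coord Q) = 0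
      rw [hR, map_mul, map_mul, hz, zero_mul]
  obtain ⟨v, hv⟩ := hu.exists_left_inv
  refine ⟨v * Polynomial.aeval coord (EuclideanDomain.gcdA P Q),
    v * Polynomial.aeval coord (EuclideanDomain.gcdB P Q), ?_⟩
  rw [EuclideanDomain.gcd_eq_gcd_ab, map_add, map_mul, map_mul] at hv
  rw [← hv]
  ring

theorem finite_eval_eq_zero {p : DiscAlgebra} (hp : p ∈ polynomials) (h0 : p ≠ 0) :
    {z | eval z p = 0}.Finite := by
  obtain ⟨P, rfl⟩ := hp
  have hP : P ≠ 0 := by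
    rintro rfl
    exact h0 (map_zero _)
  refine ((Polynomial.finite_setOfPred_isRoot hP).preimage
    (Subtype.val_injective (p := (· ∈ closedBall (0 : ℂ) 1))).injOn).subset fun z hz => ?_
  exact (eval_aeval_coord z P).symm.trans hz

end DiscAlgebra

/-! ### Density for pairs and its failure for single elements -/

namespace L1CrossedProduct

open DiscAlgebra

variable {G : Type*} [Group G] [Fintype G] [DecidableEq G] {α : AutAction G DiscAlgebra}

theorem det_rightMulMatrix_mem_polynomials
    (hα : ∀ g, ∀ f ∈ polynomials, α.aut g f ∈ polynomials) {f : L1CrossedProduct α}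
    (hf : ∀ g, f.coeff g ∈ polynomials) : (rightMulMatrix f).det ∈ polynomials := by
  rw [Matrix.det_apply']
  exact sum_mem fun σ _ => mul_mem (intCast_mem _ _) (prod_mem fun g _ => hα _ _ (hf _))

theorem coeff_add_single_algebraMap_mem_polynomials {f : L1CrossedProduct α}
    (hf : ∀ g, f.coeff g ∈ polynomials) (c : ℂ) (g : G) :
    (f + single (algebraMap ℂ DiscAlgebra c)).coeff g ∈ polynomials := by
  rw [coeff_add, coeff_single]
  split_ifs
  · exact add_mem (hf g) (Subalgebra.algebraMap_mem _ c)
  · exact add_mem (hf g) (zero_mem _)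

theorem exists_dist_add_single_lt {S : Set ℂ} (hS : S.Finite) (f : L1CrossedProduct α) {ε : ℝ}
    (hε : 0 < ε) : ∃ c ∉ S, dist f (f + single (algebraMap ℂ DiscAlgebra c)) < ε := by
  have hc : Continuous fun c : ℂ => dist f (f + single (algebraMap ℂ DiscAlgebra c)) :=
    continuous_const.dist
      (continuous_const.add (continuous_single.comp (continuous_algebraMap ℂ DiscAlgebra)))
  have h0 : (single 0 : L1CrossedProduct α) = 0 := ext fun g => by
    rw [coeff_single, ite_self, coeff_zero]
  obtain ⟨c, hcS, hc'⟩ := (hS.countable.dense_compl ℂ).exists_mem_open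
    (isOpen_Iio.preimage hc : IsOpen (_ ⁻¹' Set.Iio ε)) ⟨0, by simpa [h0] using hε⟩
  exact ⟨c, hcS, hc'⟩

theorem dense_Lg_two (hα : ∀ g, ∀ f ∈ polynomials, α.aut g f ∈ polynomials) :
    Dense (Lg 2 (L1CrossedProduct α)) := by
  intro b
  rw [Metric.mem_closure_iff]
  intro ε hε
  have hd : ∀ i, ∃ f : L1CrossedProduct α, (∀ g, f.coeff g ∈ polynomials) ∧
      dist (b i) f < ε / 2 := fun i =>
    Metric.mem_closure_iff.1 (dense_setOf_coeff_mem dense_polynomials (b i)) _ (half_pos hε)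
  choose f hf hbf using hd
  -- Making the first determinant nonzero at the single point 0 makes it a nonzero polynomial, with
  -- finitely many zeros.
  obtain ⟨c, hc, hcf⟩ := exists_dist_add_single_lt
    (finite_det_add_single_eq_zero (eval center) (f 0)) (f 0) (half_pos hε)
  set f₀ := f 0 + single (algebraMap ℂ DiscAlgebra c)
  have hf₀ : (rightMulMatrix f₀).det ∈ polynomials :=
    det_rightMulMatrix_mem_polynomials hα (coeff_add_single_algebraMap_mem_polynomials (hf 0) c)
  have hZ := finite_eval_eq_zero hf₀ (fun h => hc (by
    change eval center (rightMulMatrix f₀).det = 0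
    rw [h, map_zero]))
  -- Each of these zeros excludes only finitely many `d`, so `d` can be chosen to keep the second
  -- determinant nonzero at all of them.
  obtain ⟨d, hd, hdf⟩ := exists_dist_add_single_lt
    (hZ.biUnion fun z _ => finite_det_add_single_eq_zero (eval z) (f 1)) (f 1) (half_pos hε)
  refine ⟨_, pair_mem_Lg_of_isCoprime_det (isCoprime_of_mem_polynomials hf₀
    (det_rightMulMatrix_mem_polynomials hα
      (coeff_add_single_algebraMap_mem_polynomials (hf 1) d))
    fun z hz h => hd (Set.mem_biUnion hz h)), ?_⟩
  refine (dist_pi_lt_iff hε).2 fun i => ?_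
  fin_cases i
  · exact (dist_triangle _ (f 0) _).trans_lt (by simpa using add_lt_add (hbf 0) hcf)
  · exact (dist_triangle _ (f 1) _).trans_lt (by simpa using add_lt_add (hbf 1) hdf)

theorem not_dense_Lg_one (h0 : ∀ g, eval center (α.aut g coord) = 0)
    (h1 : ∀ g, ∀ z : closedBall (0 : ℂ) 1, ‖(z : ℂ)‖ = 1 → ‖eval z (α.aut g coord)‖ = 1) :
    ¬ Dense (Lg 1 (L1CrossedProduct α)) := by
  intro hd
  have hc : Continuous fun f : Fin 1 → L1CrossedProduct α => (rightMulMatrix (f 0)).det :=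
    continuous_det_rightMulMatrix.comp (continuous_apply 0)
  -- If `Lg 1` were dense, continuity would put the determinant of `z δ^e` in the closure of the
  -- units.
  have hmem := map_mem_closure hc (hd fun _ => single coord)
    (t := {u : DiscAlgebra | IsUnit u}) fun f hf => isUnit_det_of_mem_Lg_one hf
  rw [rightMulMatrix_single, Matrix.det_diagonal] at hmem
  refine notMem_closure_isUnit ?_ (fun z hz => ?_) hmem
  · rw [map_prod]
    exact Finset.prod_eq_zero (Finset.mem_univ 1) (h0 1)
  · rw [map_prod, norm_prod]
    exact Finset.prod_eq_one fun g _ => h1 g z hz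

end L1CrossedProduct

end

theorem mainTheorem2 (n : ℕ) [NeZero n] (ω : ℂ) (hω : ω ^ n = 1) :
    ltsr (L1CrossedProduct (DiscAlgebra.rotationAction n ω hω)) = 2 := by
  refine le_antisymm (iInf₂_le 2 ⟨one_le_two, L1CrossedProduct.dense_Lg_two fun g f hf =>
    DiscAlgebra.rotation_mem_polynomials _ hf⟩) (le_iInf₂ fun m hm => ?_)
  have hω1 : ‖ω‖ = 1 := Complex.norm_eq_one_of_pow_eq_one hω (NeZero.ne n)
  have hcoord : ∀ (g : Multiplicative (ZMod n)) (z : closedBall (0 : ℂ) 1),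
      DiscAlgebra.eval z ((DiscAlgebra.rotationAction n ω hω).aut g DiscAlgebra.coord)
        = ω ^ g.toAdd.val * z := fun g z => by
    refine DiscAlgebra.rotationAction_apply n ω hω g DiscAlgebra.coord z
      ⟨ω ^ g.toAdd.val * z, ?_⟩ rfl
    rw [mem_closedBall_zero_iff, norm_mul, norm_pow, hω1, one_pow, one_mul]
    exact mem_closedBall_zero_iff.1 z.2
  have hm1 : m ≠ 1 := by
    rintro rfl
    refine L1CrossedProduct.not_dense_Lg_one (fun g => ?_) (fun g z hz => ?_) hm.2
    · rw [hcoord]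
      exact mul_zero _
    · rw [hcoord, norm_mul, norm_pow, hω1, hz, one_pow, one_mul]
  have : 2 ≤ m := by have := hm.1; omega
  exact_mod_cast this
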